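/- Let $G$ be a finite group of order $n$. Its power graph $\Gamma_G$ has vertex set $G$, and two distinct elements are adjacent if one of them is a power of the other. In a graph, a vertex $z$ strongly resolves two vertices $x$ and $y$ if some shortest path from $z$ to $x$ contains $y$, or some shortest path from $z$ to $y$ contains $x$; a set $S$ of vertices is a strong resolving set if every pair of distinct vertices is strongly resolved by some element of $S$; and the strong metric dimension $\mathrm{sdim}(\Gamma)$ of a finite connected graph $\Gamma$ is the smallest cardinality of a strong resolving set of $\Gamma$. Then $\mathrm{sdim}(\Gamma_G)=n-2$ if and only if $G$ is one of the following groups, up to isomorphism: (i) the cyclic group $\mathbb{Z}_{pq}$, where $p$ and $q$ are two distinct prime numbers; (ii) the generalized quaternion group $Q_{2^m}$ of order $2^m$, where $m\ge 3$; here $Q_{4k}=\langle x,y : x^k=y^2,\ x^{2k}=1,\ y^{-1}xy=x^{-1}\rangle$ for $k\ge 2$; (iii) a noncyclic CP-group (a group in which every element has prime power order, the identity being allowed with order $p^0=1$) in which any two distinct maximal cyclic subgroups intersect trivially, a maximal cyclic subgroup being one that is maximal under inclusion among the cyclic subgroups. -/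

import Mathlib

namespace SimpleGraph

/-- `z` strongly resolves `x` and `y`: some shortest path from `z` to `x` contains `y`, or some
shortest path from `z` to `y` contains `x`. -/
def StronglyResolves {V : Type*} (Γ : SimpleGraph V) (z x y : V) : Prop :=
  (∃ w : Γ.Walk z x, w.IsPath ∧ w.length = Γ.dist z x ∧ y ∈ w.support) ∨
  (∃ w : Γ.Walk z y, w.IsPath ∧ w.length = Γ.dist z y ∧ x ∈ w.support)

/-- A set of vertices such that every pair of (distinct) vertices is strongly resolved by one of
its elements. -/
def IsStrongResolvingSet {V : Type*} (Γ : SimpleGraph V) (S : Set V) : Prop :=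
  ∀ x y : V, x ≠ y → ∃ z ∈ S, Γ.StronglyResolves z x y

/-- The strong metric dimension: the smallest cardinality of a strong resolving set. In a finite
connected graph the set of all vertices is strong resolving, so the minimum exists. -/
noncomputable def strongMetricDim {V : Type*} (Γ : SimpleGraph V) : ℕ :=
  sInf {k : ℕ | ∃ S : Finset V, Γ.IsStrongResolvingSet (S : Set V) ∧ S.card = k}

end SimpleGraph

/-- The power graph of a group: two distinct elements are adjacent if one is a power of the
other. -/
def powerGraph (G : Type*) [Group G] : SimpleGraph G where
  Adj x y := x ≠ y ∧ ((∃ k : ℕ, y = x ^ k) ∨ (∃ k : ℕ, x = y ^ k))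
  symm := ⟨fun _ _ h => ⟨h.1.symm, h.2.symm⟩⟩
  loopless := ⟨fun _ h => h.1 rfl⟩

/-- A CP-group: every element has prime power order (the identity has order `p ^ 0`). -/
def IsCPGroup (G : Type*) [Group G] : Prop :=
  ∀ g : G, ∃ p k : ℕ, p.Prime ∧ orderOf g = p ^ k

/-- A maximal cyclic subgroup: maximal for inclusion among the cyclic subgroups. -/
def IsMaximalCyclicSubgroup {G : Type*} [Group G] (M : Subgroup G) : Prop :=
  Maximal (fun H : Subgroup G => IsCyclic H) M

/-! The identity is adjacent to every other vertex, so geodesics have length at most 2, and a set is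
strong resolving iff its complement is a clique whose members have distinct closed neighbourhoods.
Such a clique has at most one universal vertex and can always be enlarged by one, so its maximal
size is 2 iff the graph is not complete and adjacent nonuniversal vertices have equal closed
neighbourhoods: this is `PowerTransitive`.

For groups, an element of order `p * q` must then be universal and generate `G`. Otherwise `G` is a
noncyclic CP-group. A universal `w ≠ 1` makes it a `p`-group with a unique subgroup of order `p`,
hence generalized quaternion; if only `1` is universal, a common nontrivial element would link the
generators of two maximal cyclic subgroups. The converses are direct.

The quaternion case takes `⟨a⟩` of maximal order and `x` outside normalizing it, with `x ^ p ∈ ⟨a⟩`.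
Expanding `(x * a ^ i) ^ p` gives a geometric sum; unless it is divisible by `p ^ 2`, some `x * a ^
i` has order `p`, a contradiction. This excludes odd `p` and for `p = 2` forces inversion. -/

namespace SimpleGraph

/-! ### Strong metric dimension of graphs with a universal vertex -/

variable {V : Type*} {Γ : SimpleGraph V}

theorem Walk.eq_or_adj_of_mem_support {e : V} (he : ∀ v, v ≠ e → Γ.Adj e v) {z x y : V}
    (hxy : x ≠ y) (w : Γ.Walk z x) (hw : w.length = Γ.dist z x) (hy : y ∈ w.support) :
    z = y ∨ (Γ.Adj z y ∧ Γ.Adj y x ∧ z ≠ x ∧ ¬ Γ.Adj z x) := by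
  classical
  by_cases hzy : z = y
  · exact Or.inl hzy
  refine Or.inr ?_
  have hspec := congrArg Walk.length (w.take_spec hy)
  rw [Walk.length_append] at hspec
  have h1 : (w.takeUntil y hy).length ≠ 0 := fun h => hzy (Walk.eq_of_length_eq_zero h)
  have h2 : (w.dropUntil y hy).length ≠ 0 := fun h => hxy (Walk.eq_of_length_eq_zero h).symm
  have hzx : z ≠ x := by
    rintro rfl
    rw [dist_self] at hw
    omega
  have hnadj : ¬ Γ.Adj z x := fun h => by
    rw [dist_eq_one_iff_adj.2 h] at hw
    omega
  have hd : Γ.dist z x ≤ 2 := by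
    by_cases hze : z = e
    · subst hze
      exact absurd (he x hzx.symm) hnadj
    by_cases hxe : x = e
    · subst hxe
      exact absurd (he z hzx).symm hnadj
    exact dist_le (Walk.cons (he z hze).symm (Walk.cons (he x hxe) Walk.nil))
  exact ⟨Walk.adj_of_length_eq_one (p := w.takeUntil y hy) (by omega),
    Walk.adj_of_length_eq_one (p := w.dropUntil y hy) (by omega), hzx, hnadj⟩

theorem exists_walk_of_adj_of_adj {z x y : V} (hzy : Γ.Adj z y) (hyx : Γ.Adj y x) (hzx : z ≠ x)
    (hn : ¬ Γ.Adj z x) :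
    ∃ w : Γ.Walk z x, w.IsPath ∧ w.length = Γ.dist z x ∧ y ∈ w.support := by
  let w : Γ.Walk z x := Walk.cons hzy (Walk.cons hyx Walk.nil)
  have hle : Γ.dist z x ≤ 2 := dist_le w
  have h0 : Γ.dist z x ≠ 0 := fun h => hzx
    ((Reachable.dist_eq_zero_iff w.reachable).1 h)
  have h1 : Γ.dist z x ≠ 1 := fun h => hn (dist_eq_one_iff_adj.1 h)
  have hl : w.length = Γ.dist z x := by
    change 2 = _
    omega
  exact ⟨w, Walk.isPath_of_length_eq_dist w hl, hl, by simp [w]⟩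

theorem stronglyResolves_left {z x y : V} (h : Γ.Reachable x y) (hz : z = x) :
    Γ.StronglyResolves z x y := by
  subst hz
  obtain ⟨w, hw⟩ := h.exists_walk_length_eq_dist
  exact Or.inr ⟨w, Walk.isPath_of_length_eq_dist w hw, hw, w.start_mem_support⟩

theorem StronglyResolves.symm {z x y : V} (h : Γ.StronglyResolves z x y) :
    Γ.StronglyResolves z y x := Or.symm h

/-- In a graph with a vertex adjacent to all others, the complement of a strong resolving set is a
clique without closed twins, and conversely. -/
theorem isStrongResolvingSet_iff {e : V} (he : ∀ v, v ≠ e → Γ.Adj e v) (S : Set V) :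
    Γ.IsStrongResolvingSet S ↔ ∀ x ∉ S, ∀ y ∉ S, x ≠ y →
      Γ.Adj x y ∧ ∃ u, ¬ ((x = u ∨ Γ.Adj x u) ↔ (y = u ∨ Γ.Adj y u)) := by
  have hreach : ∀ v, Γ.Reachable e v := fun v => by
    by_cases h : v = e
    · rw [h]
    · exact (he v h).reachable
  constructor
  · intro h x hx y hy hxy
    obtain ⟨z, hz, ⟨w, -, hw, hm⟩ | ⟨w, -, hw, hm⟩⟩ := h x y hxy
    · rcases w.eq_or_adj_of_mem_support he hxy hw hm with rfl | ⟨h1, h2, h3, h4⟩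
      · exact absurd hz hy
      · refine ⟨h2.symm, z, fun hiff => ?_⟩
        rcases hiff.2 (Or.inr h1.symm) with h | h
        exacts [h3 h.symm, h4 h.symm]
    · rcases w.eq_or_adj_of_mem_support he hxy.symm hw hm with rfl | ⟨h1, h2, h3, h4⟩
      · exact absurd hz hx
      · refine ⟨h2, z, fun hiff => ?_⟩
        rcases hiff.1 (Or.inr h1.symm) with h | h
        exacts [h3 h.symm, h4 h.symm]
  · intro h x y hxy
    have hr : Γ.Reachable x y := (hreach x).symm.trans (hreach y)
    by_cases hx : x ∈ S
    · exact ⟨x, hx, stronglyResolves_left hr rfl⟩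
    by_cases hy : y ∈ S
    · exact ⟨y, hy, (stronglyResolves_left hr.symm rfl).symm⟩
    -- A vertex `u` seen by `x` but not by `y` lies in `S`, because the complement is a clique, and
    -- `u, x, y` is then a geodesic.
    have key : ∀ x ∉ S, ∀ y ∉ S, x ≠ y → ∀ u, (x = u ∨ Γ.Adj x u) → ¬ (y = u ∨ Γ.Adj y u) →
        ∃ z ∈ S, Γ.StronglyResolves z x y := by
      intro x hx y hy hxy u hu hnu
      push Not at hnu
      have hadj := (h x hx y hy hxy).1
      have hxu : Γ.Adj x u := hu.resolve_left (by rintro rfl; exact hnu.2 hadj.symm)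
      refine ⟨u, ?_, Or.inr (exists_walk_of_adj_of_adj hxu.symm hadj hnu.1.symm
        fun hc => hnu.2 hc.symm)⟩
      by_contra huS
      exact hnu.2 (h y hy u huS hnu.1).1
    obtain ⟨u, hu⟩ := (h x hx y hy hxy).2
    by_cases h1 : x = u ∨ Γ.Adj x u
    · exact key x hx y hy hxy u h1 fun h2 => hu (iff_of_true h1 h2)
    · by_cases h2 : y = u ∨ Γ.Adj y u
      · obtain ⟨z, hz, hs⟩ := key y hy x hx hxy.symm u h2 h1
        exact ⟨z, hz, hs.symm⟩
      · exact absurd (iff_of_false h1 h2) hu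

/-- A graph with a vertex `e` adjacent to all others has strong metric dimension two less than its
order iff it is not complete and adjacency is transitive away from the vertices that are adjacent to
all others. -/
theorem strongMetricDim_eq_card_sub_two_iff [Finite V] {e : V} (he : ∀ v, v ≠ e → Γ.Adj e v)
    (R : V → V → Prop) (hR : ∀ x y, R x y ↔ x = y ∨ Γ.Adj x y) :
    (Γ.strongMetricDim : ℤ) = (Nat.card V : ℤ) - 2 ↔
      (∃ x y, ¬ R x y) ∧
        ∀ x y, R x y → (¬ ∀ u, R x u) → (¬ ∀ u, R y u) → ∀ u, R x u → R y u := by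
  classical
  have := Fintype.ofFinite V
  rw [Nat.card_eq_fintype_card]
  have hsymm : ∀ x y, R x y → R y x := fun x y => by
    rw [hR, hR]
    exact Or.imp Eq.symm fun h => h.symm
  have heR : ∀ u, R e u := fun u => by
    rw [hR]
    by_cases h : u = e
    exacts [Or.inl h.symm, Or.inr (he u h)]
  have hS : ∀ S : Set V, Γ.IsStrongResolvingSet S ↔ ∀ x ∉ S, ∀ y ∉ S, x ≠ y →
      R x y ∧ ∃ u, ¬ (R x u ↔ R y u) := fun S => by
    rw [isStrongResolvingSet_iff he]
    simp only [hR]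
    refine forall₅_congr fun x hx y hy hxy => ?_
    simp [hxy]
  have hle : ∀ T : Finset V, (∀ x ∈ T, ∀ y ∈ T, x ≠ y → R x y ∧ ∃ u, ¬ (R x u ↔ R y u)) →
      Γ.strongMetricDim ≤ Fintype.card V - T.card := fun T hT => by
    rw [← Finset.card_compl]
    refine Nat.sInf_le ⟨Tᶜ, (hS _).2 ?_, rfl⟩
    simpa using hT
  obtain ⟨S, hSr, hSc⟩ : Γ.strongMetricDim ∈
      {k : ℕ | ∃ S : Finset V, Γ.IsStrongResolvingSet (S : Set V) ∧ S.card = k} :=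
    Nat.sInf_mem ⟨_, Finset.univ, (hS _).2 (by simp), rfl⟩
  rw [hS] at hSr
  have hcompl := Finset.card_compl_add_card S
  constructor
  · intro h
    have h2 : 1 < (Sᶜ).card := by omega
    obtain ⟨x, hx, y, hy, hxy⟩ := Finset.one_lt_card.1 h2
    rw [Finset.mem_compl] at hx hy
    refine ⟨?_, fun x y hxy hx hy u hxu => ?_⟩
    · obtain ⟨-, u, hu⟩ := hSr x (by simpa using hx) y (by simpa using hy) hxy
      by_contra! hall
      exact hu (iff_of_true (hall _ _) (hall _ _))
    · by_contra hyu
      push Not at hx hy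
      obtain ⟨x', hx'⟩ := hx
      obtain ⟨y', hy'⟩ := hy
      have hne : x ≠ y := by
        rintro rfl
        exact hyu hxu
      have hex : e ≠ x := by
        rintro rfl
        exact hx' (heR _)
      have hey : e ≠ y := by
        rintro rfl
        exact hy' (heR _)
      have hc : ({e, x, y} : Finset V).card = 3 := Finset.card_eq_three.2
        ⟨e, x, y, hex, hey, hne, rfl⟩
      -- A failure of transitivity gives the twin-free clique `{e, x, y}`, pushing the dimension
      -- down to `n - 3`.
      have h3 := hle {e, x, y} (by
        have h12 : ∃ u, ¬ (R e u ↔ R x u) := ⟨x', fun h => hx' (h.1 (heR _))⟩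
        have h13 : ∃ u, ¬ (R e u ↔ R y u) := ⟨y', fun h => hy' (h.1 (heR _))⟩
        have h23 : ∃ u, ¬ (R x u ↔ R y u) := ⟨u, fun h => hyu (h.1 hxu)⟩
        have hs : ∀ a b, (∃ u, ¬ (R a u ↔ R b u)) → ∃ u, ¬ (R b u ↔ R a u) :=
          fun a b ⟨u, hu⟩ => ⟨u, fun h => hu h.symm⟩
        have q1 := heR x
        have q2 := heR y
        have q3 := hsymm _ _ q1
        have q4 := hsymm _ _ q2
        have q5 := hsymm _ _ hxy
        have r1 := hs _ _ h12
        have r2 := hs _ _ h13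
        have r3 := hs _ _ h23
        intro a ha b hb hab
        simp only [Finset.mem_insert, Finset.mem_singleton] at ha hb
        rcases ha with rfl | rfl | rfl <;> rcases hb with rfl | rfl | rfl <;>
          first
            | exact absurd rfl hab
            | exact ⟨by assumption, by assumption⟩)
      have h3' : 3 ≤ Fintype.card V := hc ▸ Finset.card_le_univ _
      omega
  · rintro ⟨⟨x, y, hxy⟩, hstar⟩
    have hex : e ≠ x := by
      rintro rfl
      exact hxy (heR _)
    have h2 := hle {e, x} (by
      intro a ha b hb hab
      simp only [Finset.mem_insert, Finset.mem_singleton] at ha hb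
      rcases ha with rfl | rfl <;> rcases hb with rfl | rfl
      · exact absurd rfl hab
      · exact ⟨heR _, y, fun h => hxy (h.1 (heR _))⟩
      · exact ⟨hsymm _ _ (heR _), y, fun h => hxy (h.2 (heR _))⟩
      · exact absurd rfl hab)
    have hc : ({e, x} : Finset V).card = 2 := Finset.card_pair hex
    have hcard : 2 ≤ Fintype.card V := hc ▸ Finset.card_le_univ _
    by_contra hne
    have h3 : 2 < (Sᶜ).card := by omega
    obtain ⟨a, ha, b, hb, c, hc, hab, hac, hbc⟩ := Finset.two_lt_card.1 h3
    -- Exactly one vertex of each pair outside `S` is universal, which is impossible for three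
    -- vertices.
    have hpair : ∀ a ∈ Sᶜ, ∀ b ∈ Sᶜ, a ≠ b →
        ((∀ u, R a u) ∧ ¬ ∀ u, R b u) ∨ ((∀ u, R b u) ∧ ¬ ∀ u, R a u) := by
      intro a ha b hb hab
      rw [Finset.mem_compl] at ha hb
      obtain ⟨hRab, u, hu⟩ := hSr a (by simpa using ha) b (by simpa using hb) hab
      by_cases h1 : ∀ u, R a u <;> by_cases h2 : ∀ u, R b u
      · exact absurd (iff_of_true (h1 u) (h2 u)) hu
      · exact Or.inl ⟨h1, h2⟩
      · exact Or.inr ⟨h2, h1⟩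
      · exact absurd ⟨hstar a b hRab h1 h2 u, hstar b a (hsymm _ _ hRab) h2 h1 u⟩ hu
    have := hpair a ha b hb hab
    have := hpair a ha c hc hac
    have := hpair b hb c hc hbc
    tauto

end SimpleGraph

section PowerGraphs

open Subgroup

/-! ### Cyclic subgroups and conjugation exponents -/

section CyclicSubgroups

variable {G : Type*} [Group G]

/-- With `d = orderOf y`, the cyclic group `⟨g⟩` has at most `d` solutions of `a ^ d = 1`, and `⟨y⟩`
already supplies `d` of them. -/
theorem mem_zpowers_of_orderOf_dvd [Finite G] {g x y : G} (hx : x ∈ zpowers g)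
    (hy : y ∈ zpowers g) (h : orderOf x ∣ orderOf y) : x ∈ zpowers y := by
  classical
  have := Fintype.ofFinite G
  let X : zpowers g := ⟨x, hx⟩
  let Y : zpowers g := ⟨y, hy⟩
  have hpos : 0 < orderOf y := orderOf_pos y
  have h1 := IsCyclic.card_pow_eq_one_le (α := zpowers g) hpos
  have hY : orderOf Y = orderOf y := Subgroup.orderOf_mk y hy
  have hsub : (Finset.univ.filter fun a : zpowers g => a ∈ zpowers Y) ⊆
      Finset.univ.filter fun a : zpowers g => a ^ orderOf y = 1 := by
    intro a ha
    simp only [Finset.mem_filter, Finset.mem_univ, true_and] at ha ⊢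
    rw [← hY]
    exact orderOf_dvd_iff_pow_eq_one.1 (orderOf_dvd_of_mem_zpowers ha)
  have hcard : (Finset.univ.filter fun a : zpowers g => a ∈ zpowers Y).card = orderOf y := by
    rw [← hY, ← Nat.card_zpowers, Nat.card_eq_fintype_card, Fintype.card_subtype]
  have heq := Finset.eq_of_subset_of_card_le hsub (hcard ▸ h1)
  have hX : X ∈ Finset.univ.filter fun a : zpowers g => a ^ orderOf y = 1 := by
    simp only [Finset.mem_filter, Finset.mem_univ, true_and]
    apply Subtype.ext
    exact orderOf_dvd_iff_pow_eq_one.1 h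
  rw [← heq] at hX
  simp only [Finset.mem_filter, Finset.mem_univ, true_and] at hX
  obtain ⟨k, hk⟩ := hX
  exact ⟨k, congrArg Subtype.val hk⟩

theorem zpowers_eq_of_mem_of_orderOf_le [Finite G] {x y : G} (h : x ∈ zpowers y)
    (hle : orderOf y ≤ orderOf x) : zpowers x = zpowers y :=
  Subgroup.eq_of_le_of_card_ge (zpowers_le.2 h) (by simpa [Nat.card_zpowers] using hle)

theorem mul_zpow_geom_sum {x b : G} {t : ℤ} (h : x⁻¹ * b * x = b ^ t) (k : ℕ) :
    (x * b) ^ k = x ^ k * b ^ (∑ i ∈ Finset.range k, t ^ i) := by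
  have hc : ∀ s : ℤ, b ^ s * x = x * b ^ (t * s) := fun s => by
    have h1 := congrArg (· ^ s) h
    simp only [← zpow_mul] at h1
    have h2 : (x⁻¹ * b * x) ^ s = x⁻¹ * b ^ s * x := by
      simpa using (conj_zpow (i := s) (a := x⁻¹) (b := b))
    rw [← h1, h2]
    group
  induction k with
  | zero => simp
  | succ k ih =>
    rw [pow_succ, ih, geom_sum_succ, zpow_add_one, mul_assoc, ← mul_assoc _ x b, hc, pow_succ]
    group

theorem conj_pow_eq_zpow_pow {x a : G} {t : ℤ} (h : x⁻¹ * a * x = a ^ t) (k : ℕ) :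
    (x ^ k)⁻¹ * a * x ^ k = a ^ (t ^ k) := by
  induction k with
  | zero => simp
  | succ k ih =>
    calc (x ^ (k + 1))⁻¹ * a * x ^ (k + 1) = x⁻¹ * ((x ^ k)⁻¹ * a * x ^ k) * x := by
          rw [pow_succ]; group
      _ = x⁻¹ * a ^ (t ^ k) * x := by rw [ih]
      _ = (x⁻¹ * a * x) ^ (t ^ k) := by
          simpa using (conj_zpow (i := t ^ k) (a := x⁻¹) (b := a)).symm
      _ = a ^ (t ^ (k + 1)) := by rw [h, ← zpow_mul, pow_succ']

/-- A conjugation by `x` with `x ^ p ∈ ⟨a⟩` acts on `⟨a⟩` by an exponent which is `1` modulo `p`. -/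
theorem dvd_sub_one_of_conj_eq {p : ℕ} [hp : Fact p.Prime] {a x : G} {m : ℕ} (ha : a ≠ 1)
    (hao : orderOf a = p ^ m) (hxp : x ^ p ∈ zpowers a) {t : ℤ} (ht : x⁻¹ * a * x = a ^ t) :
    (p : ℤ) ∣ t - 1 := by
  obtain ⟨j, hj⟩ := hxp
  have h1 := conj_pow_eq_zpow_pow ht p
  simp only at hj
  rw [← hj] at h1
  -- Conjugation by `x ^ p` fixes `a`, so `t ^ p` is `1` modulo `p`; Fermat replaces `t ^ p` by `t`.
  have h2 : a ^ (1 : ℤ) = a ^ (t ^ p) := by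
    rw [← h1]
    group
  rw [zpow_eq_zpow_iff_modEq, hao, Int.modEq_iff_dvd] at h2
  have hm : m ≠ 0 := by
    rintro rfl
    exact ha (orderOf_eq_one_iff.1 (by simpa using hao))
  have h3 : (p : ℤ) ∣ t ^ p - 1 := (by exact_mod_cast dvd_pow_self p hm : (p : ℤ) ∣
    ((p ^ m : ℕ) : ℤ)).trans h2
  rw [← ZMod.intCast_zmod_eq_zero_iff_dvd] at h3 ⊢
  simpa [ZMod.pow_card] using h3

end CyclicSubgroups

/-! ### `p`-groups with a unique subgroup of order `p` -/

section UniqueSubgroup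

variable {G : Type*} [Group G] [Finite G] {p : ℕ}

theorem not_pow_eq_one_of_notMem [hp : Fact p.Prime] {z a y : G} (hz : orderOf z = p)
    (hmin : ∀ g : G, g ≠ 1 → z ∈ zpowers g) (ha : a ≠ 1) (hy : y ∉ zpowers a) : y ^ p ≠ 1 := by
  intro h
  have hy1 : y ≠ 1 := by
    rintro rfl
    exact hy (one_mem _)
  have ho : orderOf y = p := orderOf_eq_prime h hy1
  have he := zpowers_eq_of_mem_of_orderOf_le (hmin y hy1) (by omega)
  have : y ∈ zpowers z := he ▸ mem_zpowers y
  exact hy ((zpowers_le.2 (hmin a ha)) this)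

/-- Otherwise `a` is a power of `x ^ p`, and maximality of the order of `a` forces `⟨x⟩ = ⟨a⟩`. -/
theorem dvd_of_pow_eq_zpow [hp : Fact p.Prime] {a x : G} {m : ℕ} (hao : orderOf a = p ^ m)
    (hmax : ∀ g : G, orderOf g ≤ orderOf a) (hx : x ∉ zpowers a) {j : ℤ}
    (hj : x ^ p = a ^ j) : (p : ℤ) ∣ j := by
  by_contra hpj
  have hcop : IsCoprime j ((p ^ m : ℕ) : ℤ) := by
    push_cast
    exact (((Nat.prime_iff_prime_int.1 hp.out).coprime_iff_not_dvd.2 hpj).symm).pow_right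
  obtain ⟨u, v, huv⟩ := hcop
  have ha : a = (x ^ p) ^ u := by
    rw [hj, ← zpow_mul]
    nth_rw 1 [← zpow_one a]
    rw [← huv, zpow_add, mul_comm v, zpow_mul _ _ v, zpow_natCast, ← hao, pow_orderOf_eq_one,
      one_zpow, mul_one, mul_comm u j]
  have hax : a ∈ zpowers x := by
    rw [ha]
    exact zpow_mem (pow_mem (mem_zpowers x) _) _
  exact hx (zpowers_eq_of_mem_of_orderOf_le hax (hmax x) ▸ mem_zpowers x)

/-- If the geometric sum is `p` times a unit modulo `p`, some `x * a ^ i` has order `p`. -/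
theorem false_of_geom_sum_eq [hp : Fact p.Prime] {z a x : G} {m : ℕ} (hz : orderOf z = p)
    (hmin : ∀ g : G, g ≠ 1 → z ∈ zpowers g) (ha : a ≠ 1) (hao : orderOf a = p ^ m)
    (hmax : ∀ g : G, orderOf g ≤ orderOf a) (hx : x ∉ zpowers a) (hxp : x ^ p ∈ zpowers a)
    {t u : ℤ} (ht : x⁻¹ * a * x = a ^ t) (hu : ∑ i ∈ Finset.range p, t ^ i = p * u)
    (hpu : ¬ (p : ℤ) ∣ u) : False := by
  obtain ⟨j, hj⟩ := hxp
  simp only at hj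
  obtain ⟨j', rfl⟩ := dvd_of_pow_eq_zpow hao hmax hx hj.symm
  have hcop : IsCoprime u ((p ^ m : ℕ) : ℤ) := by
    push_cast
    exact (((Nat.prime_iff_prime_int.1 hp.out).coprime_iff_not_dvd.2 hpu).symm).pow_right
  obtain ⟨v, w, hvw⟩ := hcop
  have hb : x⁻¹ * a ^ (-j' * v) * x = (a ^ (-j' * v)) ^ t := by
    have h := conj_zpow (i := -j' * v) (a := x⁻¹) (b := a)
    rw [inv_inv] at h
    rw [← h, ht, ← zpow_mul, ← zpow_mul, mul_comm]
  have hpow := mul_zpow_geom_sum hb p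
  -- Since `v` inverts `u` modulo `p ^ m`, the exponent `-j' * v` solves `p * j' + p * u * i ≡ 0`,
  -- which makes the `p`-th power trivial.
  refine not_pow_eq_one_of_notMem hz hmin ha (y := x * a ^ (-j' * v)) (fun hmem => hx ?_) ?_
  · exact (Subgroup.mul_mem_cancel_right _ (zpow_mem (mem_zpowers a) _)).1 hmem
  · rw [hpow, ← hj, hu, ← zpow_mul, ← zpow_add, ← orderOf_dvd_iff_zpow_eq_one, hao]
    refine ⟨p * j' * w, ?_⟩
    linear_combination (-p * j') * hvw

/-- For odd `p` the sum is `p` modulo `p ^ 2`, the linear term carrying the factor `p * (p * (p - 1)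
/ 2)`. -/
theorem geom_sum_eq_of_odd {p : ℕ} (hp : p.Prime) (hodd : Odd p) {t : ℤ}
    (ht : (p : ℤ) ∣ t - 1) : ∃ u : ℤ, ∑ i ∈ Finset.range p, t ^ i = p * u ∧ ¬ (p : ℤ) ∣ u := by
  obtain ⟨b, hb⟩ := ht
  obtain rfl : t = 1 + p * b := by linarith
  obtain ⟨c, hc⟩ := odd_sq_dvd_geom_sum₂_sub (1 : ℤ) b hodd
  simp only [one_pow, mul_one] at hc
  refine ⟨1 + p * c, by linear_combination hc, fun h => ?_⟩
  have h1 : (p : ℤ) ∣ 1 := (dvd_add_left (dvd_mul_right _ _)).1 h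
  exact hp.one_lt.ne' (by exact_mod_cast Int.eq_one_of_dvd_one (by positivity) h1)

end UniqueSubgroup

/-! ### The case `p = 2`: elements normalizing `⟨a⟩` act by inversion -/

section Quaternion

variable {G : Type*} [Group G]

theorem eq_of_mem_zpowers_of_sq_eq_one {z y : G} (hy : y ^ 2 = 1) (hz : z ≠ 1)
    (h : z ∈ zpowers y) : z = y := by
  obtain ⟨k, rfl⟩ := h
  simp only at hz ⊢
  obtain ⟨l, rfl⟩ | ⟨l, rfl⟩ := Int.even_or_odd k
  · exact absurd (by rw [← two_mul, zpow_mul, zpow_ofNat, hy, one_zpow]) hz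
  · rw [zpow_add, zpow_mul, zpow_ofNat, hy, one_zpow, one_mul, zpow_one]

variable [Finite G]

theorem mem_normalizer_zpowers {a x : G} (h : x * a * x⁻¹ ∈ zpowers a) :
    x ∈ normalizer (zpowers a : Set G) := by
  have hle : (zpowers a).map (MulAut.conj x).toMonoidHom ≤ zpowers a := by
    rw [MonoidHom.map_zpowers, zpowers_le]
    exact h
  have heq := Subgroup.eq_of_le_of_card_ge hle
    (Nat.card_congr ((zpowers a).equivMapOfInjective _ (MulAut.conj x).injective).toEquiv).le
  rw [mem_normalizer_iff]
  intro y
  constructor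
  · intro hy
    exact hle (mem_map_of_mem _ hy)
  · intro hy
    obtain ⟨w, hw, hwy⟩ := heq.ge hy
    have : w = y := (MulAut.conj x).injective hwy
    exact this ▸ hw

variable {z a x : G} {m : ℕ}

/-- For `p = 2` the geometric sum is `1 + t`; it is even, and being twice an odd number is excluded.
-/
theorem four_dvd_one_add (hz : orderOf z = 2) (hmin : ∀ g : G, g ≠ 1 → z ∈ zpowers g)
    (ha : a ≠ 1) (hao : orderOf a = 2 ^ m) (hmax : ∀ g : G, orderOf g ≤ orderOf a)
    (hx : x ∉ zpowers a) (hx2 : x ^ 2 ∈ zpowers a) {t : ℤ} (ht : x⁻¹ * a * x = a ^ t) :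
    (4 : ℤ) ∣ 1 + t := by
  have h2 := dvd_sub_one_of_conj_eq (p := 2) ha hao hx2 ht
  by_contra h4
  obtain ⟨c, hc⟩ := h2
  push_cast at hc
  refine false_of_geom_sum_eq (p := 2) (u := c + 1) hz hmin ha hao hmax hx hx2 ht ?_ ?_
  · simp only [Finset.sum_range_succ, Finset.sum_range_zero]
    push_cast
    linear_combination hc
  · push_cast
    omega

/-- As `x` commutes with `x ^ 2 = a ^ (2 * j')`, the order of `a` divides `2 * j' * (t - 1)`. Here
`t - 1` is twice an odd number, so `x ^ 4 = 1`, and `z` is the only involution. -/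
theorem sq_eq_of_sq_mem_zpowers (hz : orderOf z = 2) (hmin : ∀ g : G, g ≠ 1 → z ∈ zpowers g)
    (ha : a ≠ 1) (hao : orderOf a = 2 ^ m) (hmax : ∀ g : G, orderOf g ≤ orderOf a)
    (hx : x ∉ zpowers a) (hx2 : x ^ 2 ∈ zpowers a) {t : ℤ} (ht : x⁻¹ * a * x = a ^ t) :
    x ^ 2 = z := by
  obtain ⟨c, hc⟩ := four_dvd_one_add hz hmin ha hao hmax hx hx2 ht
  have hz1 : z ≠ 1 := by
    rintro rfl
    simp at hz
  have hne : x ^ 2 ≠ 1 := not_pow_eq_one_of_notMem hz hmin ha hx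
  obtain ⟨j, hj⟩ := hx2
  simp only at hj
  obtain ⟨j', rfl⟩ := dvd_of_pow_eq_zpow (p := 2) hao hmax hx hj.symm
  refine (eq_of_mem_zpowers_of_sq_eq_one ?_ hz1 (hmin _ hne)).symm
  have h1 : x⁻¹ * a ^ (((2 : ℕ) : ℤ) * j') * x = a ^ (t * (((2 : ℕ) : ℤ) * j')) := by
    have h := conj_zpow (i := ((2 : ℕ) : ℤ) * j') (a := x⁻¹) (b := a)
    rw [inv_inv] at h
    rw [← h, ht, ← zpow_mul]
  have h2 : a ^ (((2 : ℕ) : ℤ) * j') = a ^ (t * (((2 : ℕ) : ℤ) * j')) := by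
    rw [← h1, hj]
    group
  rw [zpow_eq_zpow_iff_modEq, hao, Int.modEq_iff_dvd] at h2
  push_cast at h2
  have hcop : IsCoprime ((2 : ℤ) ^ m) (2 * c - 1) :=
    IsCoprime.pow_left ⟨c, -1, by ring⟩
  have h3 : (2 : ℤ) ^ m ∣ 2 * j' * 2 := by
    refine hcop.dvd_of_dvd_mul_right (z := (2 * c - 1)) ?_
    rwa [show 2 * j' * 2 * (2 * c - 1) = t * (2 * j') - 2 * j' by
      linear_combination (-2 * j') * hc]
  rw [← hj, ← zpow_natCast, ← zpow_mul, ← orderOf_dvd_iff_zpow_eq_one, hao]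
  exact_mod_cast h3

/-- Both `x` and `x * a` have square `z`, while `(x * a) ^ 2 = x ^ 2 * a ^ (1 + t)`. -/
theorem conj_eq_inv_of_sq_mem_zpowers (hz : orderOf z = 2)
    (hmin : ∀ g : G, g ≠ 1 → z ∈ zpowers g)
    (ha : a ≠ 1) (hao : orderOf a = 2 ^ m) (hmax : ∀ g : G, orderOf g ≤ orderOf a)
    (hx : x ∉ zpowers a) (hx2 : x ^ 2 ∈ zpowers a) (hconj : x⁻¹ * a * x ∈ zpowers a) :
    x⁻¹ * a * x = a⁻¹ := by
  obtain ⟨t, ht⟩ := hconj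
  replace ht := ht.symm
  simp only at ht
  have h1 := sq_eq_of_sq_mem_zpowers hz hmin ha hao hmax hx hx2 ht
  have hpow := mul_zpow_geom_sum ht 2
  have hxa : x * a ∉ zpowers a := fun h =>
    hx ((Subgroup.mul_mem_cancel_right _ (mem_zpowers a)).1 h)
  have h2 : (x * a) ^ 2 = z := by
    refine sq_eq_of_sq_mem_zpowers hz hmin ha hao hmax hxa (t := t) ?_ ?_
    · rw [hpow]
      exact mul_mem hx2 (zpow_mem (mem_zpowers a) _)
    · calc (x * a)⁻¹ * a * (x * a) = a⁻¹ * (x⁻¹ * a * x) * a := by group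
        _ = a ^ t := by rw [ht]; group
  rw [h2, h1, left_eq_mul] at hpow
  simp only [Finset.sum_range_succ, Finset.sum_range_zero, pow_zero, pow_one, zero_add] at hpow
  rw [ht]
  refine eq_inv_of_mul_eq_one_right ?_
  rw [← hpow, zpow_add, zpow_one]

theorem two_le_of_orderOf_eq_two_pow (hz : orderOf z = 2) (hmin : ∀ g : G, g ≠ 1 → z ∈ zpowers g)
    (ha : a ≠ 1) (hao : orderOf a = 2 ^ m) (hmax : ∀ g : G, orderOf g ≤ orderOf a)
    (hx : x ∉ zpowers a) : 2 ≤ m := by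
  by_contra hm
  have h2 : orderOf a ∣ 2 := by
    rw [hao]
    exact pow_dvd_pow 2 (by omega : m ≤ 1)
  have h3 := Nat.le_of_dvd (by norm_num) h2
  have h4 := hmax x
  have h5 : orderOf x ≠ 1 := by
    rw [Ne, orderOf_eq_one_iff]
    rintro rfl
    exact hx (one_mem _)
  have h6 : 0 < orderOf x := orderOf_pos x
  refine not_pow_eq_one_of_notMem hz hmin ha hx ?_
  rw [← orderOf_dvd_iff_pow_eq_one]
  exact (by omega : orderOf x = 2) ▸ dvd_rfl

/-- If a higher power were needed, the last `x ^ 2 ^ k` outside `⟨a⟩` would act by a square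
exponent, and no square is `-1` modulo `4`. -/
theorem sq_mem_zpowers_of_mem_normalizer (hG : IsPGroup 2 G) (hz : orderOf z = 2)
    (hmin : ∀ g : G, g ≠ 1 → z ∈ zpowers g)
    (ha : a ≠ 1) (hao : orderOf a = 2 ^ m) (hmax : ∀ g : G, orderOf g ≤ orderOf a)
    (hx : x ∉ zpowers a) (hconj : x⁻¹ * a * x ∈ zpowers a) : x ^ 2 ∈ zpowers a := by
  classical
  have hm := two_le_of_orderOf_eq_two_pow hz hmin ha hao hmax hx
  have hex : ∃ r, x ^ 2 ^ r ∈ zpowers a := by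
    obtain ⟨k, hk⟩ := hG x
    exact ⟨k, hk ▸ one_mem _⟩
  obtain ⟨t, ht⟩ := hconj
  replace ht := ht.symm
  simp only at ht
  have hspec := Nat.find_spec hex
  obtain ⟨r, hr⟩ : ∃ r, Nat.find hex = r := ⟨_, rfl⟩
  rw [hr] at hspec
  rcases r with _ | _ | r
  · simp [hx] at hspec
  · simpa using hspec
  · exfalso
    have hmin1 : x ^ 2 ^ (r + 1) ∉ zpowers a := Nat.find_min hex (by omega)
    have h1 := conj_pow_eq_zpow_pow ht (2 ^ (r + 1))
    have h2 : (x ^ 2 ^ (r + 1)) ^ 2 ∈ zpowers a := by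
      rwa [← pow_mul, ← pow_succ]
    have h4 := four_dvd_one_add hz hmin ha hao hmax hmin1 h2 h1
    have h5 : t ^ 2 ^ (r + 1) = t ^ 2 ^ r * t ^ 2 ^ r := by
      rw [← pow_add, ← two_mul, pow_succ']
    rw [h5] at h4
    generalize t ^ 2 ^ r = s at h4
    obtain ⟨l, rfl⟩ | ⟨l, rfl⟩ := Int.even_or_odd s <;> ring_nf at h4 <;> omega

end Quaternion

/-! ### Recognizing generalized quaternion groups -/

section Recognition

variable {G : Type*} [Group G]

theorem nonempty_mulEquiv_quaternionGroup_of_generators {n : ℕ} {a x : G} (ha : orderOf a = 2 * n)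
    (hx2 : x ^ 2 = a ^ n) (hxa : x⁻¹ * a * x = a⁻¹) (hx : x ∉ zpowers a)
    (hall : ∀ g, g ∈ zpowers a ∨ x⁻¹ * g ∈ zpowers a) :
    Nonempty (G ≃* QuaternionGroup n) := by
  -- `P i` is `a ^ i` with the exponent taken in `ZMod (2 * n)`, to match the constructors of
  -- `QuaternionGroup`.
  obtain ⟨P, hPz, hPadd, hPsub⟩ : ∃ P : ZMod (2 * n) → G, (∀ k : ℤ, P k = a ^ k) ∧
      (∀ i j, P (i + j) = P i * P j) ∧ (∀ i j, P (i - j) = P i * (P j)⁻¹) := by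
    let f : ZMod (2 * n) →+ Additive G := ZMod.lift (2 * n)
      ⟨zmultiplesHom (Additive G) (Additive.ofMul a), by
        rw [zmultiplesHom_apply, natCast_zsmul, ← ofMul_pow, ← ha, pow_orderOf_eq_one, ofMul_one]⟩
    refine ⟨fun i => (f i).toMul, fun k => ?_, fun i j => ?_, fun i j => ?_⟩
    · simp [f]
    · simp
    · simp [sub_eq_add_neg]
  have hPx : ∀ i, P i * x = x * (P i)⁻¹ := fun i => by
    obtain ⟨k, rfl⟩ := ZMod.intCast_surjective i
    have h := conj_zpow (i := k) (a := x⁻¹) (b := a)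
    rw [inv_inv, hxa] at h
    rw [hPz, ← inv_zpow, h]
    group
  have hPn : P n = x ^ 2 := by
    rw [hx2]
    exact_mod_cast hPz n
  have hPcomm : ∀ i j, P i * (P j)⁻¹ = (P j)⁻¹ * P i := fun i j =>
    (show Commute (P i) (P j) by rw [Commute, SemiconjBy, ← hPadd, ← hPadd, add_comm]).inv_right.eq
  have hPmem : ∀ i, P i ∈ zpowers a := fun i => by
    obtain ⟨k, rfl⟩ := ZMod.intCast_surjective i
    exact hPz k ▸ zpow_mem (mem_zpowers a) k
  have hPinj : ∀ i j, P i = P j → i = j := fun i j h => by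
    obtain ⟨k, rfl⟩ := ZMod.intCast_surjective i
    obtain ⟨l, rfl⟩ := ZMod.intCast_surjective j
    rw [hPz, hPz, zpow_eq_zpow_iff_modEq, ha] at h
    exact (ZMod.intCast_eq_intCast_iff _ _ _).2 h
  let F : QuaternionGroup n → G := fun q => match q with
    | .a i => P i
    | .xa i => x * P i
  have hmul : ∀ q r, F (q * r) = F q * F r := by
    rintro (i | i) (j | j)
    · exact hPadd i j
    · change x * P (j - i) = P i * (x * P j)
      rw [hPsub, hPcomm, ← mul_assoc (P i), hPx, mul_assoc]
    · change x * P (i + j) = x * P i * P j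
      rw [hPadd, mul_assoc]
    · change P (n + j - i) = x * P i * (x * P j)
      rw [hPsub, hPadd, hPn, mul_assoc, hPcomm, mul_assoc x (P i), ← mul_assoc (P i), hPx]
      simp only [sq]
      group
  refine ⟨(MulEquiv.ofBijective (MonoidHom.mk' F hmul) ⟨?_, fun g => ?_⟩).symm⟩
  · have hne : ∀ i j, x * P i ≠ P j := fun i j h => hx <| by
      rw [← eq_mul_inv_iff_mul_eq] at h
      exact h ▸ mul_mem (hPmem j) (inv_mem (hPmem i))
    rintro (i | i) (j | j) h
    · exact congrArg _ (hPinj i j h)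
    · exact absurd h.symm (hne j i)
    · exact absurd h (hne i j)
    · exact congrArg _ (hPinj i j (mul_left_cancel h))
  · rcases hall g with ⟨k, hk⟩ | ⟨k, hk⟩
    · exact ⟨.a k, (hPz k).trans hk⟩
    · refine ⟨.xa k, ?_⟩
      change x * P k = g
      rw [hPz]
      simp only at hk
      rw [hk, mul_inv_cancel_left]

variable [Finite G]

/-- A proper subgroup of a nilpotent group is proper in its normalizer; `x` is the last iterated
`p`-th power of a normalizing element that is still outside `⟨a⟩`. -/
theorem exists_notMem_pow_mem_zpowers {p : ℕ} [hp : Fact p.Prime] (hG : IsPGroup p G) {a : G}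
    (ha : zpowers a ≠ ⊤) :
    ∃ x, x ∉ zpowers a ∧ x ^ p ∈ zpowers a ∧ x⁻¹ * a * x ∈ zpowers a := by
  classical
  have := hG.isNilpotent
  obtain ⟨-, hlt⟩ := SetLike.lt_iff_le_and_exists.1
    (Group.normalizerCondition_of_isNilpotent (zpowers a) ha.lt_top)
  obtain ⟨y, hyN, hy⟩ := hlt
  have hex : ∃ r, y ^ p ^ r ∈ zpowers a := by
    obtain ⟨k, hk⟩ := hG y
    exact ⟨k, hk ▸ one_mem _⟩
  have hspec := Nat.find_spec hex
  obtain ⟨r, hr⟩ : ∃ r, Nat.find hex = r := ⟨_, rfl⟩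
  rw [hr] at hspec
  rcases r with _ | r
  · simp [hy] at hspec
  · refine ⟨y ^ p ^ r, Nat.find_min hex (by omega), ?_, ?_⟩
    · rwa [← pow_mul, ← pow_succ]
    · have := mem_normalizer_iff.1 (inv_mem (pow_mem hyN (p ^ r))) a
      simpa using this

theorem exists_forall_orderOf_le : ∃ a : G, ∀ g : G, orderOf g ≤ orderOf a :=
  Finite.exists_max _

theorem prime_eq_two_of_unique_subgroup {p : ℕ} [hp : Fact p.Prime] (hG : IsPGroup p G) {z : G}
    (hz : orderOf z = p) (hmin : ∀ g : G, g ≠ 1 → z ∈ zpowers g) (hnc : ¬ IsCyclic G) :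
    p = 2 := by
  by_contra hp2
  obtain ⟨a, hmax⟩ := exists_forall_orderOf_le (G := G)
  have htop : zpowers a ≠ ⊤ := fun h => hnc ⟨a, fun g => h.ge (mem_top g)⟩
  obtain ⟨m, hao⟩ := IsPGroup.iff_orderOf.1 hG a
  have ha : a ≠ 1 := by
    rintro rfl
    have := hmax z
    rw [hz, orderOf_one] at this
    exact absurd hp.out.one_lt this.not_gt
  obtain ⟨x, hx, hxp, t, ht⟩ := exists_notMem_pow_mem_zpowers hG htop
  obtain ⟨u, hu, hpu⟩ := geom_sum_eq_of_odd hp.out (hp.out.odd_of_ne_two hp2)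
    (dvd_sub_one_of_conj_eq ha hao hxp ht.symm)
  exact false_of_geom_sum_eq hz hmin ha hao hmax hx hxp ht.symm hu hpu

/-- A finite noncyclic `p`-group with a unique subgroup of order `p` is a generalized quaternion
group. -/
theorem nonempty_mulEquiv_quaternionGroup_of_isPGroup {p : ℕ} [hp : Fact p.Prime]
    (hG : IsPGroup p G) {z : G} (hz : orderOf z = p) (hmin : ∀ g : G, g ≠ 1 → z ∈ zpowers g)
    (hnc : ¬ IsCyclic G) :
    ∃ m : ℕ, 3 ≤ m ∧ Nonempty (G ≃* QuaternionGroup (2 ^ (m - 2))) := by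
  obtain rfl := prime_eq_two_of_unique_subgroup hG hz hmin hnc
  obtain ⟨a, hmax⟩ := exists_forall_orderOf_le (G := G)
  have htop : zpowers a ≠ ⊤ := fun h => hnc ⟨a, fun g => h.ge (mem_top g)⟩
  obtain ⟨m, hao⟩ := IsPGroup.iff_orderOf.1 hG a
  have ha : a ≠ 1 := by
    rintro rfl
    have := hmax z
    rw [hz, orderOf_one] at this
    omega
  have hz1 : z ≠ 1 := by
    rintro rfl
    simp at hz
  obtain ⟨x, hx, hx2, hconj⟩ := exists_notMem_pow_mem_zpowers hG htop
  have hm := two_le_of_orderOf_eq_two_pow hz hmin ha hao hmax hx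
  have hinv : ∀ y, y ∉ zpowers a → y⁻¹ * a * y ∈ zpowers a → y⁻¹ * a * y = a⁻¹ :=
    fun y hy hya => conj_eq_inv_of_sq_mem_zpowers hz hmin ha hao hmax hy
      (sq_mem_zpowers_of_mem_normalizer hG hz hmin ha hao hmax hy hya) hya
  have hsq : ∀ y, y ∉ zpowers a → y⁻¹ * a * y ∈ zpowers a → y ^ 2 = z := by
    intro y hy hya
    have h2 := sq_mem_zpowers_of_mem_normalizer hG hz hmin ha hao hmax hy hya
    obtain ⟨t, ht⟩ := hya
    exact sq_eq_of_sq_mem_zpowers hz hmin ha hao hmax hy h2 ht.symm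
  have hxinv := hinv x hx hconj
  have hzz : z ^ 2 = 1 := hz ▸ pow_orderOf_eq_one z
  have hza := hmin a ha
  have hazz : a ^ 2 ^ (m - 1) = z := by
    have h1 : (a ^ 2 ^ (m - 1)) ^ 2 = 1 := by
      rw [← pow_mul, ← pow_succ, Nat.sub_add_cancel (by omega), ← hao, pow_orderOf_eq_one]
    refine (eq_of_mem_zpowers_of_sq_eq_one h1 hz1 (hmin _ ?_)).symm
    intro h
    have := orderOf_dvd_of_pow_eq_one h
    rw [hao, Nat.pow_dvd_pow_iff_le_right (by norm_num)] at this
    omega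
  -- If `a` has order 4, every square is `1` or `z`, and a conjugate of `a` is a product of squares
  -- and `a⁻¹`. If the order is at least 8, the normalizer is self-normalizing: a conjugate of `a`
  -- in it but outside `⟨a⟩` would have square `z`, so `a ^ 4 = 1`.
  have hN : normalizer (zpowers a : Set G) = ⊤ := by
    rcases hm.eq_or_lt with rfl | hm3
    · have hsq1 : ∀ g : G, g ^ 2 ∈ zpowers a := by
        intro g
        by_cases hg : g ^ 2 = 1
        · exact hg ▸ one_mem _
        have hg4 : (g ^ 2) ^ 2 = 1 := by
          obtain ⟨k, hk⟩ := IsPGroup.iff_orderOf.1 hG g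
          have h1 := hmax g
          rw [hk, hao, Nat.pow_le_pow_iff_right (by norm_num)] at h1
          rw [← pow_mul, ← orderOf_dvd_iff_pow_eq_one, hk]
          exact pow_dvd_pow 2 h1
        exact eq_of_mem_zpowers_of_sq_eq_one hg4 hz1 (hmin _ hg) ▸ hza
      refine eq_top_iff.2 fun g _ => mem_normalizer_zpowers ?_
      have : g * a * g⁻¹ = (g * a) ^ 2 * a⁻¹ * (g ^ 2)⁻¹ := by
        simp only [sq]
        group
      rw [this]
      exact mul_mem (mul_mem (hsq1 _) (inv_mem (mem_zpowers a))) (inv_mem (hsq1 g))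
    · have := hG.isNilpotent
      refine normalizerCondition_iff_only_full_group_self_normalizing.1
        Group.normalizerCondition_of_isNilpotent _ (le_antisymm (fun g hg => ?_) le_normalizer)
      refine mem_normalizer_zpowers ?_
      by_contra hga
      have hmem := (mem_normalizer_iff.1 hg a).1 (le_normalizer (mem_zpowers a))
      have h1 := (mem_normalizer_iff.1 (inv_mem hmem) a).1 (mem_zpowers a)
      rw [inv_inv] at h1
      have h2 := hsq _ hga h1
      have h3 : a ^ 4 = 1 := by
        rw [conj_pow] at h2
        have h4 : (g * a ^ 2 * g⁻¹) ^ 2 = 1 := by rw [h2, hzz]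
        rw [conj_pow, conj_eq_one_iff, ← pow_mul] at h4
        exact h4
      have := Nat.le_of_dvd (by norm_num) (orderOf_dvd_of_pow_eq_one h3)
      rw [hao] at this
      have h8 : 2 ^ 3 ≤ 2 ^ m := Nat.pow_le_pow_right (by norm_num) hm3
      omega
  have hconj' : ∀ y : G, y⁻¹ * a * y ∈ zpowers a := fun y => by
    have h1 := (mem_normalizer_iff.1 (hN ▸ mem_top y⁻¹) a).1 (mem_zpowers a)
    rwa [inv_inv] at h1
  -- The order of `a` is `2 ^ m`, half the order of the group.
  refine ⟨m + 1, by omega, ?_⟩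
  rw [show m + 1 - 2 = m - 1 by omega]
  refine nonempty_mulEquiv_quaternionGroup_of_generators (a := a) (x := x) ?_ ?_ hxinv hx ?_
  · rw [hao, ← pow_succ', Nat.sub_add_cancel (by omega)]
  · rw [hazz, hsq x hx hconj]
  · intro g
    by_contra! h
    obtain ⟨h1, h2⟩ := h
    have h3 := hinv g h1 (hconj' g)
    have h4 := hinv _ h2 (hconj' _)
    -- Both `g` and `x` invert `a`, so `x⁻¹ * g` centralizes it; but `x⁻¹ * g` inverts it too.
    have h5 : a = a⁻¹ := by
      have hxi : x * a * x⁻¹ = a⁻¹ := by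
        rw [eq_inv_iff_mul_eq_one, ← mul_right_inj x⁻¹, ← mul_left_inj x]
        calc x⁻¹ * (x * a * x⁻¹ * a) * x = a * (x⁻¹ * a * x) := by group
          _ = x⁻¹ * 1 * x := by rw [hxinv]; group
      calc a = (g⁻¹ * a * g)⁻¹ := by rw [h3, inv_inv]
        _ = g⁻¹ * a⁻¹ * g := by group
        _ = (x⁻¹ * g)⁻¹ * a * (x⁻¹ * g) := by rw [← hxi]; group
        _ = a⁻¹ := h4
    have h6 : a ^ 2 = 1 := by
      rw [sq]
      nth_rw 1 [h5]
      exact inv_mul_cancel a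
    have := orderOf_dvd_of_pow_eq_one h6
    rw [hao] at this
    have := (Nat.pow_dvd_pow_iff_le_right (x := 2) (l := 1) (by norm_num)).1 this
    omega

end Recognition

/-! ### The power relation and the classification -/

section PowerRelated

variable {G : Type*} [Group G]

/-- Two elements are equal or adjacent in the power graph (of a finite group). -/
def PowerRelated (x y : G) : Prop := x ∈ zpowers y ∨ y ∈ zpowers x

/-- Elements adjacent to all others in the power graph. -/
def IsPowerUniversal (x : G) : Prop := ∀ u, PowerRelated x u

variable (G) in
/-- The power graph is not complete, and adjacency is transitive away from the universal
elements. -/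
def PowerTransitive : Prop :=
  (∃ x y : G, ¬ PowerRelated x y) ∧ ∀ x y : G, PowerRelated x y → ¬ IsPowerUniversal x →
    ¬ IsPowerUniversal y → ∀ u, PowerRelated x u → PowerRelated y u

theorem PowerRelated.symm {x y : G} (h : PowerRelated x y) : PowerRelated y x := Or.symm h

theorem isPowerUniversal_one : IsPowerUniversal (1 : G) := fun _ => Or.inl (one_mem _)

theorem PowerRelated.congr_left {x y u : G} (h : zpowers x = zpowers y)
    (hx : PowerRelated x u) : PowerRelated y u := by
  rw [PowerRelated, ← zpowers_le] at hx ⊢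
  rwa [← h]

theorem powerRelated_iff [Finite G] (x y : G) :
    PowerRelated x y ↔ x = y ∨ (powerGraph G).Adj x y := by
  simp only [PowerRelated, powerGraph, ← mem_powers_iff_mem_zpowers, Submonoid.mem_powers_iff]
  constructor
  · rintro (⟨k, rfl⟩ | ⟨k, rfl⟩)
    · exact or_iff_not_imp_left.2 fun h => ⟨h, Or.inr ⟨k, rfl⟩⟩
    · exact or_iff_not_imp_left.2 fun h => ⟨h, Or.inl ⟨k, rfl⟩⟩
  · rintro (rfl | ⟨-, ⟨k, rfl⟩ | ⟨k, rfl⟩⟩)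
    · exact Or.inl ⟨1, pow_one x⟩
    · exact Or.inr ⟨k, rfl⟩
    · exact Or.inl ⟨k, rfl⟩

theorem strongMetricDim_powerGraph_iff [Finite G] :
    ((powerGraph G).strongMetricDim : ℤ) = (Nat.card G : ℤ) - 2 ↔ PowerTransitive G :=
  SimpleGraph.strongMetricDim_eq_card_sub_two_iff (e := (1 : G))
    (fun v hv => ((powerRelated_iff 1 v).1 (isPowerUniversal_one v)).resolve_left hv.symm)
    PowerRelated powerRelated_iff

/-- The powers of `u` of orders `p` and `q` are unrelated, so neither is universal; a nonuniversal
`u` would link them. -/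
theorem isPowerUniversal_of_orderOf_eq_mul (h : PowerTransitive G) {p q : ℕ} (hp : p.Prime)
    (hq : q.Prime) (hpq : p ≠ q) {u : G} (hu : orderOf u = p * q) : IsPowerUniversal u := by
  have ha : orderOf (u ^ q) = p := by
    rw [orderOf_pow_of_dvd hq.ne_zero (hu ▸ dvd_mul_left q p), hu,
      Nat.mul_div_cancel _ hq.pos]
  have hb : orderOf (u ^ p) = q := by
    rw [orderOf_pow_of_dvd hp.ne_zero (hu ▸ dvd_mul_right p q), hu,
      Nat.mul_div_cancel_left _ hp.pos]
  have hab : ¬ PowerRelated (u ^ q) (u ^ p) := by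
    rintro (h | h)
    · have := orderOf_dvd_of_mem_zpowers h
      rw [ha, hb] at this
      exact hpq ((Nat.prime_dvd_prime_iff_eq hp hq).1 this)
    · have := orderOf_dvd_of_mem_zpowers h
      rw [ha, hb] at this
      exact hpq ((Nat.prime_dvd_prime_iff_eq hq hp).1 this).symm
  by_contra hU
  exact hab (h.2 u (u ^ q) (Or.inr (pow_mem (mem_zpowers u) q)) hU (fun h' => hab (h' _)) _
    (Or.inr (pow_mem (mem_zpowers u) p)))

variable [Finite G]

theorem powerRelated_of_mem_zpowers {p k : ℕ} (hp : p.Prime) {g x y : G}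
    (hg : orderOf g = p ^ k) (hx : x ∈ zpowers g) (hy : y ∈ zpowers g) : PowerRelated x y := by
  obtain ⟨i, -, hi⟩ := (Nat.dvd_prime_pow hp).1 (hg ▸ orderOf_dvd_of_mem_zpowers hx)
  obtain ⟨j, -, hj⟩ := (Nat.dvd_prime_pow hp).1 (hg ▸ orderOf_dvd_of_mem_zpowers hy)
  rcases le_total i j with h | h
  · exact Or.inl (mem_zpowers_of_orderOf_dvd hx hy (by rw [hi, hj]; exact pow_dvd_pow p h))
  · exact Or.inr (mem_zpowers_of_orderOf_dvd hy hx (by rw [hi, hj]; exact pow_dvd_pow p h))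

theorem zpowers_eq_top_of_isPowerUniversal {p q : ℕ} (hp : p.Prime)
    (hq : q.Prime) (hpq : p ≠ q) {u : G} (hu : orderOf u = p * q) (hU : IsPowerUniversal u) :
    zpowers u = ⊤ := by
  refine eq_top_iff.2 fun g _ => ?_
  by_contra hg
  have hug := (hU g).resolve_right hg
  obtain ⟨k, hk⟩ := hu ▸ orderOf_dvd_of_mem_zpowers hug
  have hk1 : k ≠ 1 := by
    rintro rfl
    exact hg (zpowers_eq_of_mem_of_orderOf_le hug (by rw [hk, hu, mul_one]) ▸ mem_zpowers g)
  obtain ⟨r, hr, l, rfl⟩ := Nat.exists_prime_and_dvd hk1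
  -- A power of `g` of order `s * r` is related to `u`, of order `s * t`, which forces `r = t`.
  -- Applied both ways this gives `p = r = q`.
  have key : ∀ s t : ℕ, s.Prime → t.Prime → orderOf u = s * t →
      orderOf g = s * t * (r * l) → r = t := by
    intro s t hs ht hu hg
    have ho := orderOf_pow_orderOf_div (orderOf_pos g).ne' (n := s * r)
      (by rw [hg]; exact ⟨t * l, by ring⟩)
    rcases hU (g ^ (orderOf g / (s * r))) with h | h <;>
    · have := orderOf_dvd_of_mem_zpowers h
      rw [ho, hu] at this
      have := Nat.dvd_of_mul_dvd_mul_left hs.pos this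
      first
        | exact ((Nat.prime_dvd_prime_iff_eq ht hr).1 this).symm
        | exact (Nat.prime_dvd_prime_iff_eq hr ht).1 this
  exact hpq ((key q p hq hp (by rw [hu, mul_comm]) (by rw [hk, mul_comm q p])).symm.trans
    (key p q hp hq hu hk))

theorem isCPGroup_or_exists_orderOf_eq_mul :
    IsCPGroup G ∨ ∃ p q : ℕ, p.Prime ∧ q.Prime ∧ p ≠ q ∧ ∃ u : G, orderOf u = p * q := by
  rw [or_iff_not_imp_left]
  intro h
  simp only [IsCPGroup] at h
  push Not at h
  obtain ⟨g, hg⟩ := h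
  have h0 : orderOf g ≠ 0 := (orderOf_pos g).ne'
  obtain ⟨p, hp, hpg⟩ := Nat.exists_prime_and_dvd 
    (show orderOf g ≠ 1 from fun h1 => hg 2 0 Nat.prime_two (by rw [h1, pow_zero]))
  obtain ⟨q, hq, hqg, hqp⟩ : ∃ q, q.Prime ∧ q ∣ orderOf g ∧ q ≠ p := by
    by_contra! hall
    exact hg p _ hp (Nat.eq_prime_pow_of_unique_prime_dvd h0 fun {d} hd hdg => hall d hd hdg)
  refine ⟨p, q, hp, hq, hqp.symm, _, orderOf_pow_orderOf_div h0 ?_⟩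
  exact Nat.Coprime.mul_dvd_of_dvd_of_dvd ((Nat.coprime_primes hp hq).2 hqp.symm) hpg hqg

theorem not_isCyclic_of_isCPGroup (h : ∃ x y : G, ¬ PowerRelated x y) (hcp : IsCPGroup G) :
    ¬ IsCyclic G := by
  rintro ⟨g, hg⟩
  obtain ⟨x, y, hxy⟩ := h
  obtain ⟨p, k, hp, hk⟩ := hcp g
  exact hxy (powerRelated_of_mem_zpowers hp hk (hg x) (hg y))

/-- An element `z` of prime order in `⟨w⟩` lies in every nontrivial cyclic subgroup, so a single
prime divides all orders. -/
theorem quaternion_of_isPowerUniversal (hcp : IsCPGroup G) (hnc : ¬ IsCyclic G) {w : G}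
    (hw1 : w ≠ 1) (hw : IsPowerUniversal w) :
    ∃ m : ℕ, 3 ≤ m ∧ Nonempty (G ≃* QuaternionGroup (2 ^ (m - 2))) := by
  obtain ⟨p, k, hp, hk⟩ := hcp w
  have := Fact.mk hp
  have hk0 : k ≠ 0 := by
    rintro rfl
    exact hw1 (orderOf_eq_one_iff.1 (by simpa using hk))
  obtain ⟨z, hzw, hz⟩ : ∃ z ∈ zpowers w, orderOf z = p :=
    ⟨_, pow_mem (mem_zpowers w) _, orderOf_pow_orderOf_div (orderOf_pos w).ne'
      (hk ▸ dvd_pow_self p hk0)⟩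
  have hmin : ∀ g : G, g ≠ 1 → z ∈ zpowers g := by
    intro g hg
    rcases hw g with h | h
    · exact zpowers_le.2 h hzw
    · refine mem_zpowers_of_orderOf_dvd hzw h ?_
      obtain ⟨i, -, hi⟩ := (Nat.dvd_prime_pow hp).1 (hk ▸ orderOf_dvd_of_mem_zpowers h)
      have hi0 : i ≠ 0 := by
        rintro rfl
        exact hg (orderOf_eq_one_iff.1 (by simpa using hi))
      rw [hz, hi]
      exact dvd_pow_self p hi0
  refine nonempty_mulEquiv_quaternionGroup_of_isPGroup (IsPGroup.iff_orderOf.2 fun g => ?_)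
    hz hmin hnc
  by_cases hg : g = 1
  · exact ⟨0, by simp [hg]⟩
  obtain ⟨q, l, hq, hl⟩ := hcp g
  have hdvd := orderOf_dvd_of_mem_zpowers (hmin g hg)
  rw [hz, hl] at hdvd
  obtain rfl := (Nat.prime_dvd_prime_iff_eq hp hq).1 (hp.dvd_of_dvd_pow hdvd)
  exact ⟨l, hl⟩

theorem classification_of_powerTransitive (h : PowerTransitive G) :
    (∃ p q : ℕ, p.Prime ∧ q.Prime ∧ p ≠ q ∧
        Nonempty (G ≃* Multiplicative (ZMod (p * q)))) ∨
      (∃ m : ℕ, 3 ≤ m ∧ Nonempty (G ≃* QuaternionGroup (2 ^ (m - 2)))) ∨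
      (¬ IsCyclic G ∧ IsCPGroup G ∧
        ∀ M N : Subgroup G, IsMaximalCyclicSubgroup M → IsMaximalCyclicSubgroup N →
          M ≠ N → M ⊓ N = ⊥) := by
  rcases isCPGroup_or_exists_orderOf_eq_mul (G := G) with hcp | ⟨p, q, hp, hq, hpq, u, hu⟩
  swap
  · have htop := zpowers_eq_top_of_isPowerUniversal hp hq hpq hu
      (isPowerUniversal_of_orderOf_eq_mul h hp hq hpq hu)
    refine Or.inl ⟨p, q, hp, hq, hpq, ⟨(zmodMulEquivOfGenerator (g := u)
      (fun g => htop.ge (mem_top g)) ?_).symm⟩⟩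
    rw [← hu, ← Nat.card_zpowers, htop, card_top]
  have hnc := not_isCyclic_of_isCPGroup h.1 hcp
  by_cases hw : ∃ w : G, w ≠ 1 ∧ IsPowerUniversal w
  · obtain ⟨w, hw1, hw⟩ := hw
    exact Or.inr (Or.inl (quaternion_of_isPowerUniversal hcp hnc hw1 hw))
  push Not at hw
  refine Or.inr (Or.inr ⟨hnc, hcp, fun M N hM hN hMN => ?_⟩)
  rw [eq_bot_iff]
  rintro w ⟨hwM, hwN⟩
  by_contra hw1
  rw [mem_bot] at hw1
  obtain ⟨a, rfl⟩ := M.isCyclic_iff_exists_zpowers_eq_top.1 hM.prop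
  obtain ⟨b, rfl⟩ := N.isCyclic_iff_exists_zpowers_eq_top.1 hN.prop
  have hab : ¬ PowerRelated a b := by
    rintro (hab | hab)
    · exact hMN (hM.eq_of_le hN.prop (zpowers_le.2 hab))
    · exact hMN (hN.eq_of_le hM.prop (zpowers_le.2 hab)).symm
  -- The common element `w` is not universal, so transitivity through it relates `a` to `b`.
  exact hab (h.2 w a (Or.inl hwM) (hw w hw1) (fun h' => hab (h' b)) b (Or.inl hwN))

end PowerRelated

/-! ### The listed groups satisfy the transitivity condition -/

section PowerTransitiveGroups

variable {G : Type*} [Group G]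

theorem PowerTransitive.of_mulEquiv {H : Type*} [Group H] (e : G ≃* H) (h : PowerTransitive H) :
    PowerTransitive G := by
  have hmem : ∀ x y : G, e x ∈ zpowers (e y) ↔ x ∈ zpowers y := fun x y => by
    have h1 := MonoidHom.map_zpowers e.toMonoidHom y
    have h2 : e x ∈ (zpowers y).map e.toMonoidHom ↔ x ∈ zpowers y :=
      mem_map_iff_mem e.injective
    rwa [h1] at h2
  have hR : ∀ x y : G, PowerRelated (e x) (e y) ↔ PowerRelated x y := fun x y =>
    or_congr (hmem x y) (hmem y x)
  have hU : ∀ x : G, IsPowerUniversal (e x) → IsPowerUniversal x := fun x hx u =>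
    (hR x u).1 (hx (e u))
  obtain ⟨⟨x, y, hxy⟩, hstar⟩ := h
  refine ⟨⟨e.symm x, e.symm y, ?_⟩, fun x y hxy hx hy u hxu => ?_⟩
  · rwa [← hR, e.apply_symm_apply, e.apply_symm_apply]
  · rw [← hR] at hxy hxu ⊢
    exact hstar _ _ hxy (fun h => hx (hU _ h)) (fun h => hy (hU _ h)) _ hxu

variable [Finite G]

/-- Nonuniversal elements have prime order, so two related ones generate the same subgroup. -/
theorem powerTransitive_of_isCyclic {p q : ℕ} (hp : p.Prime) (hq : q.Prime) (hpq : p ≠ q)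
    [IsCyclic G] (hcard : Nat.card G = p * q) : PowerTransitive G := by
  obtain ⟨g, hg⟩ := IsCyclic.exists_generator (α := G)
  have hgo : orderOf g = p * q := by
    rw [← hcard]
    exact orderOf_eq_card_of_forall_mem_zpowers hg
  have key : ∀ x y : G, orderOf x ∣ orderOf y → x ∈ zpowers y := fun x y h =>
    mem_zpowers_of_orderOf_dvd (hg x) (hg y) h
  have hprime : ∀ x : G, ¬ IsPowerUniversal x → (orderOf x).Prime := by
    intro x hx
    have hdvd : orderOf x ∣ p * q := hcard ▸ orderOf_dvd_natCard x
    rcases (Nat.dvd_mul).1 hdvd with ⟨a, b, ha, hb, hab⟩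
    rcases (Nat.dvd_prime hp).1 ha with rfl | rfl <;> rcases (Nat.dvd_prime hq).1 hb with rfl | rfl
    · refine absurd ?_ hx
      rw [orderOf_eq_one_iff.1 (show orderOf x = 1 by rw [← hab])]
      exact isPowerUniversal_one
    · rwa [← hab, one_mul]
    · rwa [← hab, mul_one]
    · exact absurd (fun u => Or.inr (key u x (hab ▸ hcard ▸ orderOf_dvd_natCard u))) hx
  refine ⟨⟨g ^ q, g ^ p, ?_⟩, fun x y hxy hx hy u hxu => ?_⟩
  · have ha : orderOf (g ^ q) = p := by
      rw [orderOf_pow_of_dvd hq.ne_zero (hgo ▸ dvd_mul_left q p), hgo, Nat.mul_div_cancel _ hq.pos]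
    have hb : orderOf (g ^ p) = q := by
      rw [orderOf_pow_of_dvd hp.ne_zero (hgo ▸ dvd_mul_right p q), hgo,
        Nat.mul_div_cancel_left _ hp.pos]
    rintro (h | h)
    · have := orderOf_dvd_of_mem_zpowers h
      rw [ha, hb] at this
      exact hpq ((Nat.prime_dvd_prime_iff_eq hp hq).1 this)
    · have := orderOf_dvd_of_mem_zpowers h
      rw [ha, hb] at this
      exact hpq ((Nat.prime_dvd_prime_iff_eq hq hp).1 this).symm
  · have ho : orderOf x = orderOf y := by
      rcases hxy with h | h
      · exact (Nat.prime_dvd_prime_iff_eq (hprime x hx) (hprime y hy)).1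
          (orderOf_dvd_of_mem_zpowers h)
      · exact ((Nat.prime_dvd_prime_iff_eq (hprime y hy) (hprime x hx)).1
          (orderOf_dvd_of_mem_zpowers h)).symm
    exact hxu.congr_left (zpowers_eq_of_mem_of_orderOf_le (key x y ho.dvd) ho.ge)

theorem exists_isMaximalCyclicSubgroup (x : G) :
    ∃ M : Subgroup G, IsMaximalCyclicSubgroup M ∧ x ∈ M := by
  obtain ⟨M, hle, hM⟩ := (Set.toFinite {H : Subgroup G | IsCyclic H}).exists_le_maximal
    (a := zpowers x) (inferInstanceAs (IsCyclic (zpowers x)))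
  exact ⟨M, hM, hle (mem_zpowers x)⟩

/-- A nonidentity element lies in only one maximal cyclic subgroup, whose order is a prime power, so
all its elements are related. -/
theorem powerTransitive_of_isCPGroup (hnc : ¬ IsCyclic G) (hcp : IsCPGroup G)
    (hMN : ∀ M N : Subgroup G, IsMaximalCyclicSubgroup M → IsMaximalCyclicSubgroup N →
      M ≠ N → M ⊓ N = ⊥) : PowerTransitive G := by
  constructor
  · by_contra! hall
    obtain ⟨a, hmax⟩ := exists_forall_orderOf_le (G := G)
    refine hnc ⟨a, fun g => ?_⟩
    rcases hall a g with h | h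
    · exact (zpowers_eq_of_mem_of_orderOf_le h (hmax g)).ge (mem_zpowers g)
    · exact h
  · intro x y hxy hx _ u hxu
    have hx1 : x ≠ 1 := by
      rintro rfl
      exact hx isPowerUniversal_one
    have hex : ∀ v, PowerRelated x v → ∃ M, IsMaximalCyclicSubgroup M ∧ x ∈ M ∧ v ∈ M := by
      rintro v (h | h)
      · obtain ⟨M, hM, hv⟩ := exists_isMaximalCyclicSubgroup v
        exact ⟨M, hM, zpowers_le.2 hv h, hv⟩
      · obtain ⟨M, hM, hv⟩ := exists_isMaximalCyclicSubgroup x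
        exact ⟨M, hM, hv, zpowers_le.2 hv h⟩
    obtain ⟨M, hM, hxM, hyM⟩ := hex y hxy
    obtain ⟨N, hN, hxN, huN⟩ := hex u hxu
    obtain rfl : M = N := by
      by_contra hne
      exact hx1 (mem_bot.1 (hMN M N hM hN hne ▸ mem_inf.2 ⟨hxM, hxN⟩))
    obtain ⟨c, rfl⟩ := M.isCyclic_iff_exists_zpowers_eq_top.1 hM.prop
    obtain ⟨p, k, hp, hk⟩ := hcp c
    exact powerRelated_of_mem_zpowers hp hk hyM huN

/-- Each `xa j` has order 4 and its powers meet `⟨a 1⟩` only in `a 0` and `a n`, both universal;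
elements of `⟨a 1⟩` are all related, its order being a power of 2. -/
theorem powerTransitive_quaternionGroup {k : ℕ} (hk : 1 ≤ k) :
    PowerTransitive (QuaternionGroup (2 ^ k)) := by
  set n := 2 ^ k with hn
  have : NeZero n := ⟨by positivity⟩
  have hn2 : 2 ≤ n := hn ▸ Nat.pow_le_pow_right (by norm_num : 0 < 2) hk
  have hmem : ∀ i : ZMod (2 * n), QuaternionGroup.a i ∈ zpowers (QuaternionGroup.a 1) := fun i => by
    rw [← mem_powers_iff_mem_zpowers]
    exact ⟨i.val, by simp⟩
  have haa : ∀ i j : ZMod (2 * n), PowerRelated (QuaternionGroup.a i) (QuaternionGroup.a j) :=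
    fun i j => powerRelated_of_mem_zpowers Nat.prime_two (k := k + 1)
      (by rw [QuaternionGroup.orderOf_a_one, pow_succ']) (hmem i) (hmem j)
  have hxa : ∀ i j : ZMod (2 * n), QuaternionGroup.xa i ∉ zpowers (QuaternionGroup.a j) := by
    intro i j h
    have h1 := zpowers_le.2 (hmem j) h
    rw [← mem_powers_iff_mem_zpowers] at h1
    obtain ⟨l, hl⟩ := h1
    simp at hl
  have hax : ∀ i j : ZMod (2 * n), PowerRelated (QuaternionGroup.a i) (QuaternionGroup.xa j) →
      i = 0 ∨ i = n := by
    intro i j h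
    have h1 := h.resolve_right (hxa j i)
    rw [← mem_powers_iff_mem_zpowers] at h1
    obtain ⟨l, hl⟩ := h1
    simp only at hl
    rw [← pow_mod_orderOf, QuaternionGroup.orderOf_xa] at hl
    have hlt : l % 4 < 4 := Nat.mod_lt _ (by norm_num)
    generalize l % 4 = r at hl hlt
    interval_cases r
    · rw [pow_zero, QuaternionGroup.one_def] at hl
      exact Or.inl (QuaternionGroup.a.inj hl).symm
    · simp at hl
    · rw [QuaternionGroup.xa_sq] at hl
      exact Or.inr (QuaternionGroup.a.inj hl).symm
    · simp [pow_succ] at hl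
  have huniv : ∀ i : ZMod (2 * n), ¬ IsPowerUniversal (QuaternionGroup.a i) → i ≠ 0 ∧ i ≠ n := by
    intro i hi
    constructor
    · rintro rfl
      exact hi isPowerUniversal_one
    · rintro rfl
      refine hi fun u => ?_
      rcases u with j | j
      · exact haa _ _
      · exact Or.inl ⟨2, by simp [zpow_ofNat]⟩
  have hno : ∀ i j, ¬ IsPowerUniversal (QuaternionGroup.a i : QuaternionGroup n) →
      ¬ PowerRelated (QuaternionGroup.a i : QuaternionGroup n) (QuaternionGroup.xa j) := by
    intro i j hi h
    have h1 := huniv i hi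
    have h2 := hax i j h
    tauto
  refine ⟨⟨QuaternionGroup.a 1, QuaternionGroup.xa 0, fun h => ?_⟩,
    fun x y hxy hx hy u hxu => ?_⟩
  · rcases hax _ _ h with h | h
    · have : Fact (1 < 2 * n) := ⟨by omega⟩
      exact one_ne_zero h
    · have h1 : ((1 : ℕ) : ZMod (2 * n)) = (n : ℕ) := by exact_mod_cast h
      rw [ZMod.natCast_eq_natCast_iff', Nat.mod_eq_of_lt (by omega),
        Nat.mod_eq_of_lt (by omega)] at h1
      omega
  · rcases x with i | i <;> rcases y with j | j
    · rcases u with l | l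
      · exact haa _ _
      · exact absurd hxu (hno _ _ hx)
    · exact absurd hxy (hno _ _ hx)
    · exact absurd hxy.symm (hno _ _ hy)
    · refine hxu.congr_left ?_
      rcases hxy with h | h
      · exact zpowers_eq_of_mem_of_orderOf_le h (by simp)
      · exact (zpowers_eq_of_mem_of_orderOf_le h (by simp)).symm

end PowerTransitiveGroups

end PowerGraphs

/-- Subtraction is in `ℤ`: truncated at zero, the equation would hold for the trivial group, whose
dimension is 0. -/
theorem corollary5p7 (G : Type*) [Group G] [Finite G] (n : ℕ) (hn : Nat.card G = n) :
    ((powerGraph G).strongMetricDim : ℤ) = (n : ℤ) - 2 ↔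
      (∃ p q : ℕ, p.Prime ∧ q.Prime ∧ p ≠ q ∧
        Nonempty (G ≃* Multiplicative (ZMod (p * q)))) ∨
      (∃ m : ℕ, 3 ≤ m ∧ Nonempty (G ≃* QuaternionGroup (2 ^ (m - 2)))) ∨
      (¬ IsCyclic G ∧ IsCPGroup G ∧
        ∀ M N : Subgroup G, IsMaximalCyclicSubgroup M → IsMaximalCyclicSubgroup N →
          M ≠ N → M ⊓ N = ⊥) := by
  subst hn
  rw [strongMetricDim_powerGraph_iff]
  refine ⟨classification_of_powerTransitive, ?_⟩
  rintro (⟨p, q, hp, hq, hpq, ⟨e⟩⟩ | ⟨m, hm, ⟨e⟩⟩ | ⟨hnc, hcp, hMN⟩)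
  · have : IsCyclic G := isCyclic_of_surjective e.symm e.symm.surjective
    refine powerTransitive_of_isCyclic hp hq hpq ?_
    rw [Nat.card_congr e.toEquiv]
    exact Nat.card_zmod _
  · exact (powerTransitive_quaternionGroup (by omega)).of_mulEquiv e
  · exact powerTransitive_of_isCPGroup hnc hcp hMN
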